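/- Let $q$ be a prime power. For a prime power $Q$ and integers $r,h\ge 1$, $s\ge 0$, a projective $h$-$(n,r,s)_Q$ system is a multiset of $n$ subspaces of $\mathbb{F}_Q^r$ of vector space dimension at most $h$ such that every hyperplane of $\mathbb{F}_Q^r$ contains at most $s$ of them (counted with multiplicity) and some hyperplane contains exactly $s$ of them. (For $s<n$ such systems correspond to the $\mathbb{F}_Q$-linear additive codes of length $n$, size $Q^r$ and minimum distance $n-s$ over the alphabet $\mathbb{F}_{Q^h}$; for $h=1$ these are the linear codes over $\mathbb{F}_Q$.) Let $n_Q(r,h;s)$ be the maximum $n$ such that a projective $h$-$(n,r,s)_Q$ system exists ($\infty$ if $n$ is unbounded), and let $\overline{n}_q(r,h;s):=n_{q^h}(\lceil r/h\rceil,1;s)$ be the value obtainable from linear codes over $\mathbb{F}_{q^h}$. Additive codes are said to outperform linear codes when $n_q(r,h;s)>\overline{n}_q(r,h;s)$. **Theorem.** Let $0\le i\le q^2$ be an integer, written as $i=aq-b$ with integers $a\ge 0$ and $0\le b\le q-1$, and let $t\ge q^2+q$ be an integer. Then $$n_q\big(6,2;(q^2+1)t-i\big)=(q^4+q^2+1)t-(q^2+1)i+\max\{a-2,0\}\cdot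 q$$ and $$n_q\big(6,2;(q^2+1)t-i\big)=\overline{n}_q\big(6,2;(q^2+1)t-i\big)+\max\{\lceil i/q\rceil-2,0\}\cdot q .$$ Moreover, there are exactly $q(q-2)$ integers $i$ with $0\le i\le q^2$ such that $n_q(6,2;(q^2+1)t-i)>\overline{n}_q(6,2;(q^2+1)t-i)$ for all integers $t\ge q^2+q$; i.e., exactly $q(q-2)$ infinite series (indexed by $t$) in which additive codes outperform linear codes. -/

import Mathlib

open Classical in
/-- A projective `h-(n, r, s)` system over the field `F`, where `n = S.card`: a multiset `S` of
subspaces of `F ^ r` of (vector space) dimension at most `h`, such that every hyperplane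
contains at most `s` members of `S`, counted with multiplicity, and some hyperplane contains
exactly `s` of them. -/
structure IsProjectiveSystem (F : Type*) [Field F] (r h s : ℕ)
    (S : Multiset (Submodule F (Fin r → F))) : Prop where
  finrank_le : ∀ U ∈ S, Module.finrank F U ≤ h
  card_le : ∀ H : Submodule F (Fin r → F), Module.finrank F H + 1 = r →
    S.countP (fun U => U ≤ H) ≤ s
  exists_card_eq : ∃ H : Submodule F (Fin r → F), Module.finrank F H + 1 = r ∧
    S.countP (fun U => U ≤ H) = s

/-- `n_q(r, h; s)` with `q = #F`: the maximum `n` such that a projective `h-(n, r, s)` system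
over `F` exists; it is `⊤` if such systems exist for arbitrarily large `n`. -/
noncomputable def maxSystemSize (F : Type*) [Field F] (r h s : ℕ) : ℕ∞ :=
  sSup {n : ℕ∞ | ∃ S : Multiset (Submodule F (Fin r → F)),
    IsProjectiveSystem F r h s S ∧ n = (Multiset.card S : ℕ∞)}

/-- The value obtainable from linear codes: if `K` has `q ^ h` elements, then this is
`n_{q ^ h}(⌈r / h⌉, 1; s)`. -/
noncomputable def linearMaxSystemSize (K : Type*) [Field K] (r h s : ℕ) : ℕ∞ :=
  maxSystemSize K ⌈(r : ℚ) / (h : ℚ)⌉₊ 1 s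

/-! Upper bound. Replace each line by its q+1 points. A hyperplane not containing the line misses at
least q of them, so linear forms on F^6 give words of length n(q+1) and weight at least q(n-s). In
the Griesmer bound the first two terms use up (q+1)(n-s), which leaves at most (q+1)s for the other
four. Dividing by q rounds in the fifth term, where i = aq-b turns into a, and this leaves exactly
the room (a-2)q when a ≥ 2 (`card_le_of_chain_six`). The same bound for points over the field K with
q^2 elements gives the linear value.

Lower bound. Identify F^6 with K^3, so that points of the plane over K are lines over F. All points
t times, minus i times the line z = 0, is optimal among linear codes. For a ≥ 2, exchange a-1 of the
copies of the q^4 affine points for families `switchLines` of q^4 lines over F, one for each of a-1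
values β = α+f with f in F. Consider the hyperplane τ(xX+yY+zZ) = 0 with coefficients x, y, z. If x
≠ 0, a family contributes q^2 lines, just like the affine points. If x = 0 and y ≠ 0, it contributes
only q^2-q unless τ(yβ) = 0, which for given y happens for at most one f. So these hyperplanes lose
at least (a-2)q, and the point (1,0,0), which lies only on hyperplanes with x = 0, can be added
(a-2)q more times. If x = y = 0, a family adds up to q^3 lines, which the i missing copies of z = 0
pay for because i > (a-1)q.

The counts are uniform because the lines come from a cubic extension T: for θ in T outside F and any
nonzero form Λ on T, the map w ↦ (Λ(w), Λ(θw)) is onto F^2 (`surjective_prod_mul`). -/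

open Module

/-! ### The Griesmer bound for systems of points and lines -/

/-- The Griesmer bound. If `X` has dimension `k` and each nonzero vector of `X` is a non-zero of at
least `d` of the linear forms `v i`, `i ∈ s`, then `s` has at least `c 0 + ⋯ + c (k - 1)` elements,
where `d ≤ c 0` and each `c (j + 1)` is at least `c j / q`. -/
theorem exists_griesmer_chain {F : Type*} [Field F] [Fintype F] [DecidableEq F] {ι : Type*} (k : ℕ) :
    ∀ {X : Type*} [AddCommGroup X] [Module F X] [FiniteDimensional F X], finrank F X = k →
      ∀ (v : ι → X →ₗ[F] F) (s : Finset ι) (d : ℕ),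
      (∀ x : X, x ≠ 0 → d ≤ (s.filter fun i => v i x ≠ 0).card) →
      ∃ c : ℕ → ℕ, d ≤ c 0 ∧ (∀ j, c j ≤ Fintype.card F * c (j + 1)) ∧
        ∑ j ∈ Finset.range k, c j ≤ s.card := by
  induction k with
  | zero =>
    intro X _ _ _ _ v s d _
    exact ⟨fun _ => d, le_rfl, fun _ => Nat.le_mul_of_pos_left _ Fintype.card_pos, by simp⟩
  | succ k ih =>
    classical
    intro X _ _ _ hX v s d hd
    have : Nontrivial X := nontrivial_of_finrank_pos (R := F) (by omega)
    have hex : ∃ w, ∃ x : X, x ≠ 0 ∧ (s.filter fun i => v i x ≠ 0).card = w := by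
      obtain ⟨x, hx⟩ := exists_ne (0 : X)
      exact ⟨_, x, hx, rfl⟩
    obtain ⟨x₀, hx₀, hw⟩ := Nat.find_spec hex
    have hmin : ∀ x : X, x ≠ 0 → Nat.find hex ≤ (s.filter fun i => v i x ≠ 0).card :=
      fun x hx => Nat.find_min' hex ⟨x, hx, rfl⟩
    set w := Nat.find hex
    obtain ⟨C, hC⟩ := Submodule.exists_isCompl (F ∙ x₀)
    have hCk : finrank F C = k := by
      have := Submodule.finrank_add_eq_of_isCompl hC
      rw [finrank_span_singleton hx₀] at this
      omega
    have hnot : ∀ x : C, x ≠ 0 → ∀ l : F, (x : X) + l • x₀ ≠ 0 := by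
      intro x hx l h
      apply hx
      have hmem : (x : X) ∈ F ∙ x₀ := by
        rw [eq_neg_of_add_eq_zero_left h]
        exact Submodule.neg_mem _ (Submodule.smul_mem _ _ (Submodule.mem_span_singleton_self _))
      exact Subtype.ext (Submodule.disjoint_def.1 hC.disjoint _ hmem x.2)
    -- Residual code: average the weights of the q words x + l x₀, each at least w. A coordinate
    -- where x₀ is nonzero vanishes for exactly one l and contributes q-1; the others contribute q
    -- or 0 according to x. Hence qw ≤ (q-1)w + q·(residual weight of x).
    have key : ∀ x : C, x ≠ 0 → w ≤ Fintype.card F *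
        ((s.filter fun i => v i x₀ = 0).filter fun i => v i x ≠ 0).card := by
      intro x hx
      have h1 : Fintype.card F * w ≤
          ∑ l : F, (s.filter fun i => v i ((x : X) + l • x₀) ≠ 0).card := by
        have := Finset.card_nsmul_le_sum (Finset.univ : Finset F)
          (fun l => (s.filter fun i => v i ((x : X) + l • x₀) ≠ 0).card) w
          (fun l _ => hmin _ (hnot x hx l))
        simpa using this
      have h2 : ∑ l : F, (s.filter fun i => v i ((x : X) + l • x₀) ≠ 0).card =
          ∑ i ∈ s, (Finset.univ.filter fun l : F => v i x + l * v i x₀ ≠ 0).card := by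
        simp only [Finset.card_filter, map_add, map_smul, smul_eq_mul]
        exact Finset.sum_comm
      have h3 : ∀ i, (Finset.univ.filter fun l : F => v i x + l * v i x₀ ≠ 0).card =
          if v i x₀ = 0 then (if v i x ≠ 0 then Fintype.card F else 0) else Fintype.card F - 1 := by
        intro i
        split_ifs with h h'
        · simp [h, h']
        · simp [h, not_not.1 h']
        · rw [← Finset.card_univ, ← Finset.card_erase_of_mem (Finset.mem_univ (-(v i x) / v i x₀))]
          congr 1
          ext l
          simp only [Finset.mem_filter, Finset.mem_univ, true_and, Finset.mem_erase, and_true,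
            ne_eq, not_iff_not]
          rw [eq_div_iff h]
          exact ⟨fun e => by linear_combination e, fun e => by linear_combination e⟩
      rw [h2, Finset.sum_congr rfl fun i _ => h3 i, Finset.sum_ite, Finset.sum_ite] at h1
      simp only [Finset.sum_const, smul_eq_mul, mul_zero, add_zero] at h1
      rw [hw] at h1
      have hq : 1 ≤ Fintype.card F := Fintype.card_pos
      obtain ⟨q', hq'⟩ : ∃ q', Fintype.card F = q' + 1 := ⟨_, (Nat.sub_add_cancel hq).symm⟩
      rw [hq'] at h1 ⊢
      simp only [Nat.add_sub_cancel] at h1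
      nlinarith
    obtain ⟨c, hc0, hc, hsum⟩ := ih hCk (fun i => (v i).domRestrict C) (s.filter fun i => v i x₀ = 0)
      (w ⌈/⌉ Fintype.card F) (by
        intro x hx
        rw [ceilDiv_le_iff_le_smul Fintype.card_pos]
        exact key x hx)
    refine ⟨fun j => Nat.casesOn j w c, ?_, ?_, ?_⟩
    · obtain ⟨x, hx, h⟩ := Nat.find_spec hex
      exact (hd x hx).trans_eq h
    · rintro (_ | j)
      · exact (ceilDiv_le_iff_le_smul Fintype.card_pos).1 hc0
      · exact hc j
    · rw [Finset.sum_range_succ']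
      have := Finset.card_filter_add_card_filter_not (s := s) (fun i => v i x₀ = 0)
      simp only [ne_eq] at hw
      change ∑ j ∈ Finset.range k, c j + w ≤ _
      omega

theorem IsProjectiveSystem.countP_le_ker {F : Type*} [Field F] {r h s : ℕ}
    {S : Multiset (Submodule F (Fin r → F))} (hS : IsProjectiveSystem F r h s S)
    {φ : Dual F (Fin r → F)} (hφ : φ ≠ 0) [DecidablePred fun U => U ≤ LinearMap.ker φ] :
    S.countP (fun U => U ≤ LinearMap.ker φ) ≤ s := by
  convert hS.card_le (LinearMap.ker φ) (by simpa using Dual.finrank_ker_add_one_of_ne_zero hφ)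

theorem Submodule.exists_le_span_singleton {F V : Type*} [Field F] [AddCommGroup V] [Module F V]
    [FiniteDimensional F V] (U : Submodule F V) (hU : finrank F U ≤ 1) : ∃ u, U ≤ F ∙ u := by
  obtain ⟨u, hu⟩ := finrank_le_one_iff.1 hU
  refine ⟨u, fun w hw => ?_⟩
  obtain ⟨c, hc⟩ := hu ⟨w, hw⟩
  exact Submodule.mem_span_singleton.2 ⟨c, congrArg Subtype.val hc⟩

theorem Submodule.exists_le_span_pair {F V : Type*} [Field F] [AddCommGroup V] [Module F V]
    [FiniteDimensional F V] (U : Submodule F V) (hU : finrank F U ≤ 2) :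
    ∃ u v, U ≤ Submodule.span F {u, v} := by
  by_cases h : U = ⊥
  · exact ⟨0, 0, h ▸ bot_le⟩
  obtain ⟨u, huU, hu⟩ := Submodule.exists_mem_ne_zero_of_ne_bot h
  obtain ⟨C, hC⟩ := Submodule.exists_isCompl (F ∙ (⟨u, huU⟩ : U))
  have hC1 := Submodule.finrank_add_eq_of_isCompl hC
  rw [finrank_span_singleton (by simpa using hu)] at hC1
  obtain ⟨v, hv⟩ := C.exists_le_span_singleton (by omega)
  refine ⟨u, v, fun w hw => ?_⟩
  have : (⟨w, hw⟩ : U) ∈ (F ∙ (⟨u, huU⟩ : U)) ⊔ C := hC.sup_eq_top ▸ Submodule.mem_top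
  obtain ⟨x, hx, y, hy, hxy⟩ := Submodule.mem_sup.1 this
  obtain ⟨a, rfl⟩ := Submodule.mem_span_singleton.1 hx
  obtain ⟨b, rfl⟩ := Submodule.mem_span_singleton.1 (hv hy)
  exact Submodule.mem_span_pair.2 ⟨a, b, congrArg Subtype.val hxy⟩

theorem Multiset.countP_eq_card_filter_univ {α : Type*} [DecidableEq α] (S : Multiset α)
    (p : α → Prop) [DecidablePred p] :
    S.countP p = (Finset.univ.filter fun x : S => p x).card := by
  conv_lhs => rw [← Multiset.map_univ_coe S]
  rw [Multiset.countP_map]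
  rfl

/-- The Griesmer bound for a multiset of points. -/
theorem IsProjectiveSystem.exists_chain_one {F : Type*} [Field F] [Fintype F] {r s : ℕ}
    {S : Multiset (Submodule F (Fin r → F))} (hS : IsProjectiveSystem F r 1 s S) :
    ∃ c : ℕ → ℕ, S.card - s ≤ c 0 ∧ (∀ j, c j ≤ Fintype.card F * c (j + 1)) ∧
      ∑ j ∈ Finset.range r, c j ≤ S.card := by
  classical
  choose u hu using fun U : S => (U : Submodule F (Fin r → F)).exists_le_span_singleton
    (hS.finrank_le U (Multiset.coe_mem))
  -- Codewords are the linear forms φ, and coordinates are evaluations at the chosen vectors; a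
  -- subspace spanned by a zero of φ lies in its kernel.
  have := exists_griesmer_chain (F := F) r (X := Dual F (Fin r → F)) (by simp)
    (fun U => Dual.eval F _ (u U)) Finset.univ (S.card - s) (fun φ hφ => by
      have h1 := hS.countP_le_ker hφ
      rw [Multiset.countP_eq_card_filter_univ] at h1
      have h2 := Finset.card_filter_add_card_filter_not (s := (Finset.univ : Finset S))
        (fun U => Dual.eval F _ (u U) φ = 0)
      rw [Finset.card_univ, Multiset.card_coe] at h2
      have h3 : (Finset.univ.filter fun U => Dual.eval F _ (u U) φ = 0).card ≤
          (Finset.univ.filter fun U : S => (U : Submodule F (Fin r → F)) ≤ LinearMap.ker φ).card := by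
        refine Finset.card_le_card fun U hU => ?_
        simp only [Finset.mem_filter, Finset.mem_univ, true_and]
        exact (hu U).trans ((Submodule.span_singleton_le_iff_mem _ _).2 (LinearMap.mem_ker.2 (Finset.mem_filter.1 hU).2))
      simp only [ne_eq]
      omega)
  simpa using this

/-- The Griesmer bound for a multiset of lines, each of which is replaced by its points. -/
theorem IsProjectiveSystem.exists_chain_two {F : Type*} [Field F] [Fintype F] {r s : ℕ}
    {S : Multiset (Submodule F (Fin r → F))} (hS : IsProjectiveSystem F r 2 s S) :
    ∃ c : ℕ → ℕ, Fintype.card F * (S.card - s) ≤ c 0 ∧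
      (∀ j, c j ≤ Fintype.card F * c (j + 1)) ∧
      ∑ j ∈ Finset.range r, c j ≤ S.card * (Fintype.card F + 1) := by
  classical
  choose u v huv using fun U : S => (U : Submodule F (Fin r → F)).exists_le_span_pair
    (hS.finrank_le U (Multiset.coe_mem))
  -- The q+1 points of the line: `none` is u and `some l` is v + l u.
  let P : S × Option F → (Fin r → F) := fun x => x.2.elim (u x.1) fun l => v x.1 + l • u x.1
  have hcard (φ : Dual F (Fin r → F)) (U : S) (hU : ¬ (U : Submodule F (Fin r → F)) ≤ LinearMap.ker φ) :
      Fintype.card F ≤ (Finset.univ.filter fun o => φ (P (U, o)) ≠ 0).card := by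
    by_cases h : φ (u U) = 0
    · have hv : φ (v U) ≠ 0 := fun hv => hU ((huv U).trans (Submodule.span_le.2 (by
        rintro x (rfl | rfl)
        exacts [h, hv])))
      rw [← Finset.card_univ, ← Finset.card_map Function.Embedding.some]
      refine Finset.card_le_card fun o ho => ?_
      obtain ⟨l, -, rfl⟩ := Finset.mem_map.1 ho
      simp [P, h, hv]
    · have : Finset.univ.erase (some (-φ (v U) / φ (u U))) ⊆
          Finset.univ.filter fun o => φ (P (U, o)) ≠ 0 := by
        rintro (_ | l) ho
        · simpa [P] using h
        · simp only [Finset.mem_erase, Finset.mem_univ, and_true, ne_eq, Option.some.injEq,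
            eq_div_iff h] at ho
          simp only [P, Option.elim_some, map_add, map_smul, smul_eq_mul, Finset.mem_filter,
            Finset.mem_univ, true_and]
          exact fun e => ho (by linear_combination e)
      have := Finset.card_le_card this
      rwa [Finset.card_erase_of_mem (Finset.mem_univ _), Finset.card_univ, Fintype.card_option] at this
  have := exists_griesmer_chain (F := F) r (X := Dual F (Fin r → F)) (by simp)
    (fun x => Dual.eval F _ (P x)) Finset.univ (Fintype.card F * (S.card - s)) (fun φ hφ => by
      have h1 := hS.countP_le_ker hφ
      rw [Multiset.countP_eq_card_filter_univ] at h1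
      have h2 := Finset.card_filter_add_card_filter_not (s := (Finset.univ : Finset S))
        (fun U => (U : Submodule F (Fin r → F)) ≤ LinearMap.ker φ)
      rw [Finset.card_univ, Multiset.card_coe] at h2
      have h3 := Finset.card_nsmul_le_sum
        (Finset.univ.filter fun U : S => ¬ (U : Submodule F (Fin r → F)) ≤ LinearMap.ker φ)
        (fun U => (Finset.univ.filter fun o => φ (P (U, o)) ≠ 0).card) _
        (fun U hU => hcard φ U (Finset.mem_filter.1 hU).2)
      have h4 : (Finset.univ.filter fun x => φ (P x) ≠ 0).card =
          ∑ U, (Finset.univ.filter fun o => φ (P (U, o)) ≠ 0).card := by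
        simp only [Finset.card_filter]
        rw [Fintype.sum_prod_type]
      refine le_trans ?_ ((h3.trans (Finset.sum_le_sum_of_subset (Finset.filter_subset _ _))).trans
        h4.ge)
      rw [smul_eq_mul, mul_comm]
      exact Nat.mul_le_mul_right _ (by omega))
  simpa using this

/-! ### Arithmetic of the Griesmer bound -/

/-- Since c 0 ≥ n - s, the other two terms sum to at most s. A larger n would force c 1 ≥ Qt - i + 1
and, as i ≤ Q, c 2 ≥ t, which is one too many. -/
theorem card_le_of_chain_three {Q n s t i : ℕ} (hi : i ≤ Q) (ht : i ≤ t)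
    (hs : s = (Q + 1) * t - i) {c : ℕ → ℕ} (h0 : n - s ≤ c 0) (hc : ∀ j, c j ≤ Q * c (j + 1))
    (hsum : ∑ j ∈ Finset.range 3, c j ≤ n) : n ≤ (Q ^ 2 + Q + 1) * t - (Q + 1) * i := by
  by_contra! hn
  have h1 := hc 0
  have h2 := hc 1
  simp only [Finset.sum_range_succ, Finset.sum_range_zero, zero_add] at hsum h1 h2
  have e1 : (Q + 1) * i ≤ (Q ^ 2 + Q + 1) * t := Nat.mul_le_mul (by nlinarith) ht
  have e2 : i ≤ (Q + 1) * t := by nlinarith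
  zify [e1, e2] at *
  have h0' : (n : ℤ) - s ≤ c 0 := by omega
  have a1 : (Q : ℤ) * t - i + 1 ≤ c 1 := by
    by_contra! h
    nlinarith
  have a2 : (t : ℤ) ≤ c 2 := by
    by_contra! h
    nlinarith
  nlinarith

/-- The terms c 0 and c 1 take (q+1)(n-s), so the last four must fit into (q+1)s. A larger n pushes
their sum above this by at least ε + 3 - a ≥ 1, where ε is the truncated a - 2. -/
theorem card_le_of_chain_six {q n s t i a b : ℕ} (hq : 2 ≤ q) (hi : i ≤ q ^ 2) (hib : i + b = a * q)
    (hb : b + 1 ≤ q) (ht : i ≤ t) (hs : s = (q ^ 2 + 1) * t - i) {c : ℕ → ℕ}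
    (h0 : q * (n - s) ≤ c 0) (hc : ∀ j, c j ≤ q * c (j + 1))
    (hsum : ∑ j ∈ Finset.range 6, c j ≤ n * (q + 1)) :
    n ≤ (q ^ 4 + q ^ 2 + 1) * t - (q ^ 2 + 1) * i + (a - 2) * q := by
  by_contra! hn
  have h1 := hc 0
  have h2 := hc 1
  have h3 := hc 2
  have h4 := hc 3
  have h5 := hc 4
  simp only [Finset.sum_range_succ, Finset.sum_range_zero, zero_add, Nat.reduceAdd] at hsum h1 h2 h3 h4 h5
  have e1 : (q ^ 2 + 1) * i ≤ (q ^ 4 + q ^ 2 + 1) * t := Nat.mul_le_mul (by nlinarith) ht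
  have e2 : i ≤ (q ^ 2 + 1) * t := by nlinarith
  have haq : a ≤ q := by
    by_contra! h
    nlinarith
  obtain ⟨ε, hε⟩ : ∃ ε, ε = a - 2 := ⟨_, rfl⟩
  rw [← hε] at hn
  have hεq : ε + 2 ≤ q := by omega
  have hn0 : (n : ℤ) - s ≤ (n - s : ℕ) := by omega
  have h0' : (q : ℤ) * (n - s) ≤ c 0 := by
    zify at h0
    nlinarith
  clear h0 hn0 hc
  have hqz : (2 : ℤ) ≤ q := by exact_mod_cast hq
  have hq0 : (0 : ℤ) < q := by linarith
  have hε0 : (0 : ℤ) ≤ ε := by positivity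
  have hb0 : (0 : ℤ) ≤ b := by positivity
  have hε' : (a : ℤ) - 2 ≤ ε := by omega
  clear hε
  zify [e1, e2] at *
  have a1 : (n : ℤ) - s ≤ c 1 := le_of_mul_le_mul_left (h0'.trans h1) hq0
  have hn' : (q : ℤ) ^ 4 * t - q ^ 2 * i + ε * q < n - s := by
    rw [hs]; linear_combination hn
  have a2 : (q : ℤ) ^ 3 * t - q * i + ε < c 2 :=
    lt_of_mul_lt_mul_left (by linear_combination hn' + a1 + h2) hq0.le
  have a3 : (q : ℤ) ^ 2 * t - i < c 3 :=
    lt_of_mul_lt_mul_left (a := (q : ℤ)) (by linear_combination a2 + h3 + hε0) hq0.le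
  -- The decisive rounding: i = aq - b with b ≥ 0 makes i/q at most a.
  have a4 : (q : ℤ) * t - a < c 4 :=
    lt_of_mul_lt_mul_left (a := (q : ℤ)) (by linear_combination a3 + h4 + hib + hb0) hq0.le
  have a5 : (t : ℤ) - 1 < c 5 :=
    lt_of_mul_lt_mul_left (a := (q : ℤ)) (by linear_combination a4 + h5 + haq) hq0.le
  have a2' := Int.add_one_le_iff.2 a2
  have a3' := Int.add_one_le_iff.2 a3
  have a4' := Int.add_one_le_iff.2 a4
  have a5' := Int.add_one_le_iff.2 a5
  have a6 : (q + 1 : ℤ) * s < c 2 + c 3 + c 4 + c 5 := by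
    rw [hs]
    linarith
  linarith

/-! ### Lower bounds from abstract spaces, and fibre counts -/

open Classical in
/-- A multiset of subspaces of an abstract vector space bounds `maxSystemSize` from below. -/
theorem card_le_maxSystemSize {F V : Type*} [Field F] [AddCommGroup V] [Module F V]
    [FiniteDimensional F V] {r h s : ℕ} (hV : finrank F V = r) (P : Multiset (Submodule F V))
    (hdim : ∀ U ∈ P, finrank F U ≤ h)
    (hle : ∀ φ : Dual F V, φ ≠ 0 → P.countP (fun U => U ≤ LinearMap.ker φ) ≤ s)
    (hex : ∃ φ : Dual F V, φ ≠ 0 ∧ P.countP (fun U => U ≤ LinearMap.ker φ) = s) :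
    (P.card : ℕ∞) ≤ maxSystemSize F r h s := by
  let e : V ≃ₗ[F] (Fin r → F) := LinearEquiv.ofFinrankEq _ _ (by simpa using hV)
  have hcount : ∀ H : Submodule F (Fin r → F),
      (P.map (Submodule.map (e : V →ₗ[F] (Fin r → F)))).countP (fun U => U ≤ H) =
        P.countP (fun U => U ≤ H.comap (e : V →ₗ[F] (Fin r → F))) := by
    intro H
    rw [Multiset.countP_map, Multiset.countP_eq_card_filter]
    simp only [Submodule.map_le_iff_le_comap]
  refine le_sSup ⟨P.map (Submodule.map (e : V →ₗ[F] (Fin r → F))), ⟨?_, ?_, ?_⟩, by simp⟩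
  · intro U hU
    obtain ⟨U', hU', rfl⟩ := Multiset.mem_map.1 hU
    exact (Submodule.finrank_map_le _ _).trans (hdim U' hU')
  · intro H hH
    have hlt : H < ⊤ := by
      refine lt_top_iff_ne_top.2 ?_
      rintro rfl
      simp at hH
    obtain ⟨f, hf, hHf⟩ := H.exists_le_ker_of_lt_top hlt
    have hker : H = LinearMap.ker f := by
      refine Submodule.eq_of_le_of_finrank_eq hHf ?_
      have := Dual.finrank_ker_add_one_of_ne_zero hf
      rw [finrank_fin_fun] at this
      omega
    rw [hcount, hker]
    refine hle (f ∘ₗ (e : V →ₗ[F] (Fin r → F))) fun h0 => hf ?_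
    ext1 x
    ext
    simpa using DFunLike.congr_fun h0 (e.symm (Pi.single x 1))
  · obtain ⟨φ, hφ, hs⟩ := hex
    refine ⟨LinearMap.ker (φ ∘ₗ (e.symm : (Fin r → F) →ₗ[F] V)), ?_, ?_⟩
    · have := Dual.finrank_ker_add_one_of_ne_zero
        (f := φ ∘ₗ (e.symm : (Fin r → F) →ₗ[F] V)) (fun h0 => hφ (by
          ext x
          simpa using DFunLike.congr_fun h0 (e x)))
      simpa using this
    · rw [hcount, ← hs]
      congr!
      ext x
      simp

theorem card_filter_eq_mul_card {F X Y : Type*} [Field F] [AddCommGroup X] [Module F X] [Fintype X]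
    [AddCommGroup Y] [Module F Y] [Fintype Y] [DecidableEq Y] (f : X →ₗ[F] Y)
    (hf : Function.Surjective f) (y : Y) :
    (Finset.univ.filter fun x => f x = y).card * Fintype.card Y = Fintype.card X := by
  have h : ∀ y', (Finset.univ.filter fun x => f x = y').card =
      (Finset.univ.filter fun x => f x = y).card := by
    intro y'
    obtain ⟨x₀, hx₀⟩ := hf (y - y')
    refine Finset.card_bij (fun x _ => x + x₀) ?_ ?_ ?_
    · intro x hx
      simp only [Finset.mem_filter, Finset.mem_univ, true_and, map_add] at hx ⊢
      rw [hx, hx₀, add_sub_cancel]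
    · intro x _ x' _ hxx
      exact add_right_cancel hxx
    · intro x hx
      simp only [Finset.mem_filter, Finset.mem_univ, true_and] at hx
      exact ⟨x - x₀, by simp [hx, hx₀], by simp⟩
  rw [← Finset.card_univ (α := X),
    Finset.card_eq_sum_card_fiberwise (f := f) (s := Finset.univ) (t := Finset.univ)
      (by simp),
    Finset.sum_congr rfl fun y' _ => h y', Finset.sum_const, Finset.card_univ, smul_eq_mul, mul_comm]

theorem card_affine_line {K : Type*} [Field K] [Fintype K] [DecidableEq K] {a b : K} (c : K)
    (hab : a ≠ 0 ∨ b ≠ 0) :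
    (Finset.univ.filter fun p : K × K => a * p.1 + b * p.2 + c = 0).card = Fintype.card K := by
  have := card_filter_eq_mul_card (F := K) (LinearMap.coprod (a • LinearMap.id) (b • LinearMap.id) :
    K × K →ₗ[K] K) (fun y => by
      rcases hab with h | h
      · exact ⟨(y / a, 0), by simp [mul_div_cancel₀, h]⟩
      · exact ⟨(0, y / b), by simp [mul_div_cancel₀, h]⟩) (-c)
  rw [Fintype.card_prod] at this
  simpa [eq_neg_iff_add_eq_zero] using Nat.eq_of_mul_eq_mul_right Fintype.card_pos this

theorem card_affine_point {K : Type*} [Field K] [Fintype K] [DecidableEq K] {a : K} (b : K)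
    (ha : a ≠ 0) : (Finset.univ.filter fun x : K => a * x + b = 0).card = 1 := by
  rw [Finset.card_eq_one]
  refine ⟨-b / a, ?_⟩
  ext x
  simp only [Finset.mem_filter, Finset.mem_univ, true_and, Finset.mem_singleton, eq_div_iff ha]
  exact ⟨fun e => by linear_combination e, fun e => by linear_combination e⟩

/-! ### Linear forms on a field extension -/

section Extension

variable {F T : Type*} [Field F] [Field T] [Algebra F T]

/-- Any nonzero τ can play the role of the trace: (a, x) ↦ τ(ax) is nondegenerate because a nonzero
a is invertible, and dimensions agree. -/
theorem exists_eq_mul_of_dual [FiniteDimensional F T] {τ : Dual F T} (hτ : τ ≠ 0) (A : Dual F T) :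
    ∃ a : T, ∀ x, A x = τ (a * x) := by
  let m : T →ₗ[F] Dual F T := (LinearMap.llcomp F T T F τ) ∘ₗ LinearMap.mul F T
  have hm : Function.Injective m := by
    refine (injective_iff_map_eq_zero m).2 fun a ha => ?_
    by_contra h
    refine hτ (LinearMap.ext fun x => ?_)
    have := DFunLike.congr_fun ha (a⁻¹ * x)
    simpa [m, mul_inv_cancel_left₀ h] using this
  obtain ⟨a, ha⟩ := (LinearMap.injective_iff_surjective_of_finrank_eq_finrank
    (Subspace.dual_finrank_eq (K := F) (V := T)).symm).1 hm A
  exact ⟨a, fun x => by rw [← ha]; rfl⟩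

/-- A form on F × F killing the image gives c + dθ with τ((c + dθ)x) = 0 for all x. Then c + dθ = 0,
which forces c = d = 0 as θ is not in F. -/
theorem surjective_prod_mul {τ : Dual F T} (hτ : τ ≠ 0) {θ : T}
    (hθ : θ ∉ Set.range (algebraMap F T)) :
    Function.Surjective (τ.prod (τ ∘ₗ LinearMap.mulLeft F θ)) := by
  rw [← LinearMap.range_eq_top]
  by_contra h
  obtain ⟨f, hf, hle⟩ := Submodule.exists_le_ker_of_lt_top _ (lt_top_iff_ne_top.2 h)
  have hfx : ∀ y : F × F, f y = f (1, 0) * y.1 + f (0, 1) * y.2 := by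
    intro y
    have : y = y.1 • ((1, 0) : F × F) + y.2 • ((0, 1) : F × F) := by ext <;> simp
    rw [this, map_add, map_smul, map_smul]
    simp [mul_comm]
  have hx : ∀ x, τ ((algebraMap F T (f (1, 0)) + algebraMap F T (f (0, 1)) * θ) * x) = 0 := by
    intro x
    have : f (τ x, τ (θ * x)) = 0 := hle ⟨x, rfl⟩
    rw [hfx] at this
    rw [add_mul, map_add, mul_assoc, ← Algebra.smul_def, ← Algebra.smul_def, map_smul, map_smul]
    exact this
  have h0 : algebraMap F T (f (1, 0)) + algebraMap F T (f (0, 1)) * θ = 0 := by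
    by_contra h0
    refine hτ (LinearMap.ext fun x => ?_)
    have := hx ((algebraMap F T (f (1, 0)) + algebraMap F T (f (0, 1)) * θ)⁻¹ * x)
    rwa [mul_inv_cancel_left₀ h0] at this
  by_cases h1 : f (0, 1) = 0
  · rw [h1, map_zero, zero_mul, add_zero, map_eq_zero] at h0
    exact hf (LinearMap.ext fun y => by rw [hfx, h0, h1]; simp)
  · have h1' : algebraMap F T (f (0, 1)) ≠ 0 := by simpa using h1
    refine hθ ⟨-f (1, 0) / f (0, 1), ?_⟩
    rw [map_div₀, map_neg, div_eq_iff h1']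
    linear_combination -h0

theorem eq_zero_of_dual_mul (hT : finrank F T = 2) {τ : Dual F T} (hτ : τ ≠ 0) {θ : T}
    (hθ : θ ∉ Set.range (algebraMap F T)) {x : T} (h : τ x = 0) (h' : τ (θ * x) = 0) : x = 0 := by
  have : FiniteDimensional F T := FiniteDimensional.of_finrank_pos (by omega)
  refine ((LinearMap.injective_iff_surjective_of_finrank_eq_finrank (by simp [hT])).2
    (surjective_prod_mul hτ hθ)) ?_
  simp [h, h']

theorem exists_notMem_range_algebraMap (hT : 1 < finrank F T) :
    ∃ θ : T, θ ∉ Set.range (algebraMap F T) := by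
  by_contra! h
  refine hT.ne' (finrank_eq_one_iff'.2 ⟨1, one_ne_zero, fun w => ?_⟩)
  obtain ⟨c, hc⟩ := h w
  exact ⟨c, by rw [Algebra.smul_def, mul_one, hc]⟩

end Extension

theorem exists_finite_extension (F : Type*) [Field F] [Fintype F] {n : ℕ} (hn : n ≠ 0) :
    ∃ (T : Type) (_ : Field T) (_ : Fintype T) (_ : Algebra F T), finrank F T = n := by
  obtain ⟨p, hp⟩ := CharP.exists F
  have : Fact p.Prime := ⟨CharP.char_is_prime F p⟩
  have : NeZero n := ⟨hn⟩
  exact ⟨FiniteField.Extension F p n, inferInstance, Fintype.ofFinite _, inferInstance,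
    FiniteField.finrank_extension F p n⟩

/-! ### The switched families of lines and their hyperplane counts -/

section Switching

variable {F K T : Type*} [Field F] [Field K] [Field T] [Algebra F K] [Algebra F T]

/-- The linear form `(x, y, z) ↦ τ (a x + b y + c z)`. -/
def dotForm (τ : Dual F K) (a b c : K) : Dual F (K × K × K) :=
  (τ ∘ₗ LinearMap.mulLeft F a).coprod
    ((τ ∘ₗ LinearMap.mulLeft F b).coprod (τ ∘ₗ LinearMap.mulLeft F c))

theorem dotForm_apply (τ : Dual F K) (a b c : K) (p : K × K × K) :
    dotForm τ a b c p = τ (a * p.1 + b * p.2.1 + c * p.2.2) := by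
  simp [dotForm, add_assoc]

theorem exists_eq_dotForm [FiniteDimensional F K] {τ : Dual F K} (hτ : τ ≠ 0)
    (φ : Dual F (K × K × K)) : ∃ a b c, φ = dotForm τ a b c := by
  obtain ⟨a, ha⟩ := exists_eq_mul_of_dual hτ (φ ∘ₗ LinearMap.inl F K (K × K))
  obtain ⟨b, hb⟩ := exists_eq_mul_of_dual hτ
    (φ ∘ₗ LinearMap.inr F K (K × K) ∘ₗ LinearMap.inl F K K)
  obtain ⟨c, hc⟩ := exists_eq_mul_of_dual hτ
    (φ ∘ₗ LinearMap.inr F K (K × K) ∘ₗ LinearMap.inr F K K)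
  refine ⟨a, b, c, LinearMap.ext fun p => ?_⟩
  rw [dotForm_apply, map_add, map_add, ← ha, ← hb, ← hc]
  simp only [LinearMap.coe_comp, Function.comp_apply, ← map_add]
  congr 1
  simp

/-- The point of the projective plane over `K` spanned by `p`, viewed as a line over `F`. -/
def pointLine (F : Type*) {K : Type*} [Field F] [Field K] [Algebra F K] (p : K × K × K) :
    Submodule F (K × K × K) :=
  LinearMap.range ((LinearMap.toSpanSingleton K (K × K × K) p).restrictScalars F)

theorem finrank_pointLine_le [FiniteDimensional F K] (p : K × K × K) :
    finrank F (pointLine F p) ≤ finrank F K :=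
  LinearMap.finrank_range_le _

/-- The values of the K-linear form on the K-span of p are all of K unless the form vanishes at p,
and τ does not vanish on K. -/
theorem pointLine_le_ker {τ : Dual F K} (hτ : τ ≠ 0) (a b c : K) (p : K × K × K) :
    pointLine F p ≤ LinearMap.ker (dotForm τ a b c) ↔ a * p.1 + b * p.2.1 + c * p.2.2 = 0 := by
  have : pointLine F p ≤ LinearMap.ker (dotForm τ a b c) ↔
      ∀ k : K, τ ((a * p.1 + b * p.2.1 + c * p.2.2) * k) = 0 := by
    rw [pointLine, LinearMap.range_le_ker_iff, LinearMap.ext_iff]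
    refine forall_congr' fun k => ?_
    simp only [LinearMap.coe_comp, Function.comp_apply, dotForm_apply, LinearMap.zero_apply]
    simp only [LinearMap.coe_restrictScalars, LinearMap.toSpanSingleton_apply, Prod.smul_fst,
      Prod.smul_snd, smul_eq_mul]
    ring_nf
  rw [this]
  refine ⟨fun h => ?_, fun h k => by rw [h, zero_mul, map_zero]⟩
  by_contra h0
  refine hτ (LinearMap.ext fun x => ?_)
  simpa [mul_inv_cancel_left₀ h0] using h ((a * p.1 + b * p.2.1 + c * p.2.2)⁻¹ * x)

theorem span_pair_le_ker {V : Type*} [AddCommGroup V] [Module F V] (φ : Dual F V) (u v : V) :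
    Submodule.span F {u, v} ≤ LinearMap.ker φ ↔ φ u = 0 ∧ φ v = 0 := by
  rw [Submodule.span_le, Set.insert_subset_iff, Set.singleton_subset_iff]
  rfl

/-- Lines that join points outside the hyperplane `K × K × F` to points `(u, β, 0)` of the plane
`K × Fβ × 0`. -/
def switchLine₀ (α β : K) (p : K × F) : Submodule F (K × K × K) :=
  Submodule.span F {(α * p.1, p.2 • (α * β), α), (p.1, β, 0)}

/-- Lines that join points outside the hyperplane `K × K × F` to points of `K × K × 0` outside the
plane `K × Fβ × 0`. -/
def switchLine₁ (α β : K) (θ : T) (e : T ≃ₗ[F] K × F) (p : Fˣ × T) : Submodule F (K × K × K) :=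
  Submodule.span F {((e (θ * p.2)).1, (e (θ * p.2)).2 • β, α + algebraMap F K p.1),
    ((e p.2).1, α * β + (e p.2).2 • β, 0)}

open Classical in
/-- Together the lines `switchLine₀` and `switchLine₁` partition the points outside the
hyperplane `K × K × F`. -/
noncomputable def switchLines [Fintype F] [Fintype K] [Fintype T] (α β : K) (θ : T) (e : T ≃ₗ[F] K × F) :
    Multiset (Submodule F (K × K × K)) :=
  Finset.univ.val.map (switchLine₀ (F := F) α β) + Finset.univ.val.map (switchLine₁ α β θ e)

theorem finrank_span_pair_le {V : Type*} [AddCommGroup V] [Module F V] (u v : V) :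
    finrank F (Submodule.span F {u, v}) ≤ 2 := by
  classical
  have := finrank_span_finset_le_card (R := F) ({u, v} : Finset V)
  rw [Finset.coe_insert, Finset.coe_singleton] at this
  exact this.trans Finset.card_le_two

theorem finrank_le_of_mem_switchLines [Fintype F] [Fintype K] [Fintype T] {α β : K} {θ : T}
    {e : T ≃ₗ[F] K × F} {U : Submodule F (K × K × K)} (hU : U ∈ switchLines α β θ e) :
    finrank F U ≤ 2 := by
  rcases Multiset.mem_add.1 hU with h | h <;> obtain ⟨p, -, rfl⟩ := Multiset.mem_map.1 h <;>
    exact finrank_span_pair_le _ _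

theorem card_switchLines [Fintype F] [Fintype K] [Fintype T] (hK : finrank F K = 2)
    (hT : finrank F T = 3) (α β : K) (θ : T) (e : T ≃ₗ[F] K × F) :
    (switchLines α β θ e).card = Fintype.card F ^ 4 := by
  classical
  have hT' := card_eq_pow_finrank (K := F) (V := T)
  have hK' := card_eq_pow_finrank (K := F) (V := K)
  simp only [switchLines, Multiset.card_add, Multiset.card_map, Finset.card_val, Finset.card_univ,
    Fintype.card_prod, Fintype.card_units, hT', hK', hT, hK]
  obtain ⟨q, hq⟩ : ∃ q, Fintype.card F = q + 1 :=
    ⟨_, (Nat.sub_add_cancel Fintype.card_pos).symm⟩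
  rw [hq, Nat.add_sub_cancel]
  ring

open Classical in
theorem countP_switchLines [Fintype F] [Fintype K] [Fintype T] (φ : Dual F (K × K × K))
    (α β : K) (θ : T) (e : T ≃ₗ[F] K × F) :
    (switchLines α β θ e).countP (fun U => U ≤ LinearMap.ker φ) =
      (Finset.univ.filter fun p : K × F => switchLine₀ α β p ≤ LinearMap.ker φ).card +
      ∑ g : Fˣ, (Finset.univ.filter fun w : T =>
        switchLine₁ α β θ e (g, w) ≤ LinearMap.ker φ).card := by
  rw [switchLines, Multiset.countP_add, Multiset.countP_map, Multiset.countP_map]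
  congr 1
  change (Finset.univ.filter fun p : Fˣ × T => _).card = _
  simp only [Finset.card_filter]
  rw [Fintype.sum_prod_type]

theorem switchLine₀_le_ker {τ : Dual F K} {a b c α β : K} {p : K × F} :
    switchLine₀ α β p ≤ LinearMap.ker (dotForm τ a b c) ↔
      τ (a * α * p.1) + p.2 * τ (α * (b * β)) = -τ (c * α) ∧ τ (a * p.1) = -τ (b * β) := by
  rw [switchLine₀, span_pair_le_ker, dotForm_apply, dotForm_apply]
  simp only [mul_zero, add_zero, mul_smul_comm, map_add, map_smul, smul_eq_mul]
  rw [eq_neg_iff_add_eq_zero, eq_neg_iff_add_eq_zero, mul_assoc, mul_left_comm α]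

/-- The form on `T` that describes which lines `switchLine₁` lie in a hyperplane. -/
def switchForm (τ : Dual F K) (a b β : K) (e : T ≃ₗ[F] K × F) : Dual F T :=
  ((τ ∘ₗ LinearMap.mulLeft F a).coprod (LinearMap.toSpanSingleton F F (τ (b * β)))) ∘ₗ
    (e : T →ₗ[F] K × F)

theorem switchForm_apply (τ : Dual F K) (a b β : K) (e : T ≃ₗ[F] K × F) (w : T) :
    switchForm τ a b β e w = τ (a * (e w).1) + (e w).2 * τ (b * β) := by
  simp [switchForm]

theorem switchForm_ne_zero {τ : Dual F K} (hτ : τ ≠ 0) {a b β : K} (e : T ≃ₗ[F] K × F)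
    (h : a ≠ 0 ∨ τ (b * β) ≠ 0) : switchForm τ a b β e ≠ 0 := by
  intro h0
  rcases h with h | h
  · refine hτ (LinearMap.ext fun x => ?_)
    have := DFunLike.congr_fun h0 (e.symm (a⁻¹ * x, 0))
    simpa [switchForm_apply, mul_inv_cancel_left₀ h] using this
  · have := DFunLike.congr_fun h0 (e.symm (0, 1))
    simp [switchForm_apply, h] at this

theorem switchLine₁_le_ker {τ : Dual F K} {a b c α β : K} {θ : T} {e : T ≃ₗ[F] K × F} {g : Fˣ}
    {w : T} : switchLine₁ α β θ e (g, w) ≤ LinearMap.ker (dotForm τ a b c) ↔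
      switchForm τ a b β e w = -τ (α * (b * β)) ∧
        switchForm τ a b β e (θ * w) = -(τ (c * α) + g * τ c) := by
  rw [switchLine₁, span_pair_le_ker, dotForm_apply, dotForm_apply, switchForm_apply,
    switchForm_apply, and_comm, eq_neg_iff_add_eq_zero, eq_neg_iff_add_eq_zero]
  have : c * algebraMap F K g = (g : F) • c := by rw [Algebra.smul_def, mul_comm]
  simp only [mul_zero, add_zero, mul_smul_comm, mul_add, map_add, map_smul, smul_eq_mul, this,
    mul_left_comm α]
  simp only [add_assoc, add_comm (τ (b * (α * β)))]

-- This is why the cubic field is used: the two conditions prescribe Λ(w) and Λ(θw) for a nonzero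
-- form Λ, so q^3/q^2 = q elements w satisfy them, whatever the prescribed values.
open Classical in
theorem card_filter_switchLine₁ [Fintype F] [Fintype T] (hT : finrank F T = 3) {τ : Dual F K} (hτ : τ ≠ 0)
    {a b c α β : K} {θ : T} (hθ : θ ∉ Set.range (algebraMap F T)) (e : T ≃ₗ[F] K × F) (g : Fˣ)
    (h : a ≠ 0 ∨ τ (b * β) ≠ 0) :
    (Finset.univ.filter fun w : T =>
      switchLine₁ α β θ e (g, w) ≤ LinearMap.ker (dotForm τ a b c)).card = Fintype.card F := by
  have := card_filter_eq_mul_card _ (surjective_prod_mul (switchForm_ne_zero hτ e h) hθ)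
    (-τ (α * (b * β)), -(τ (c * α) + g * τ c))
  rw [Fintype.card_prod, card_eq_pow_finrank (K := F) (V := T), hT, pow_succ', mul_comm,
    pow_two, mul_comm] at this
  have := Nat.eq_of_mul_eq_mul_right (Nat.mul_pos Fintype.card_pos Fintype.card_pos) this
  simp only [switchLine₁_le_ker]
  simpa [Prod.ext_iff] using this

variable [Fintype F] [Fintype K] [Fintype T]

-- The lines `switchLine₀` contribute q, and each of the q-1 values of g contributes q.
open Classical in
theorem countP_switchLines_of_ne_zero (hK : finrank F K = 2) (hT : finrank F T = 3) {τ : Dual F K}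
    (hτ : τ ≠ 0) {a b c α β : K} (hα : α ∉ Set.range (algebraMap F K)) {θ : T}
    (hθ : θ ∉ Set.range (algebraMap F T)) (e : T ≃ₗ[F] K × F) (ha : a ≠ 0) :
    (switchLines α β θ e).countP (fun U => U ≤ LinearMap.ker (dotForm τ a b c)) =
      Fintype.card F ^ 2 := by
  have h0 : (Finset.univ.filter fun p : K × F =>
      switchLine₀ α β p ≤ LinearMap.ker (dotForm τ a b c)).card = Fintype.card F := by
    have := card_filter_eq_mul_card
      (((τ ∘ₗ LinearMap.mulLeft F (a * α)).coprod
        (LinearMap.toSpanSingleton F F (τ (α * (b * β))))).prod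
        (τ ∘ₗ LinearMap.mulLeft F a ∘ₗ LinearMap.fst F K F)) (fun y => by
          -- The K-coordinate alone already reaches every pair, after dividing by a.
          obtain ⟨v, hv⟩ := surjective_prod_mul hτ hα (y.2, y.1)
          refine ⟨(a⁻¹ * v, 0), ?_⟩
          have h1 : a * α * (a⁻¹ * v) = α * v := by field_simp
          have h2 : a * (a⁻¹ * v) = v := by field_simp
          have hv1 : τ v = y.2 := congrArg Prod.fst hv
          have hv2 : τ (α * v) = y.1 := congrArg Prod.snd hv
          ext
          · change τ (a * α * (a⁻¹ * v)) + 0 * τ (α * (b * β)) = y.1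
            rw [h1, hv2, zero_mul, add_zero]
          · simpa [h2] using hv1) (-τ (c * α), -τ (b * β))
    rw [Fintype.card_prod, Fintype.card_prod, card_eq_pow_finrank (K := F) (V := K), hK,
      pow_two, mul_comm (_ * _) (Fintype.card F)] at this
    have := Nat.eq_of_mul_eq_mul_right (Nat.mul_pos Fintype.card_pos Fintype.card_pos) this
    simp only [switchLine₀_le_ker]
    simpa [Prod.ext_iff, mul_assoc] using this
  rw [countP_switchLines, h0, Finset.sum_congr rfl fun g _ =>
    card_filter_switchLine₁ hT hτ hθ e g (Or.inl ha), Finset.sum_const, Finset.card_univ,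
    Fintype.card_units, smul_eq_mul]
  obtain ⟨q, hq⟩ : ∃ q, Fintype.card F = q + 1 :=
    ⟨_, (Nat.sub_add_cancel Fintype.card_pos).symm⟩
  rw [hq, Nat.add_sub_cancel]
  ring

-- Here the hyperplane contains the plane K × Fβ × 0. Only lines `switchLine₀` can lie in it,
-- subject to one condition on the F-coordinate of the parameter. The others would need τ(αbβ) = 0,
-- hence bβ = 0.
open Classical in
theorem countP_switchLines_of_apply_eq_zero (hK : finrank F K = 2) {τ : Dual F K}
    (hτ : τ ≠ 0) {b c α β : K} (hα : α ∉ Set.range (algebraMap F K)) {θ : T}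
    (e : T ≃ₗ[F] K × F) (hb : b * β ≠ 0) (hbβ : τ (b * β) = 0) :
    (switchLines α β θ e).countP (fun U => U ≤ LinearMap.ker (dotForm τ 0 b c)) =
      Fintype.card F ^ 2 := by
  have hne : τ (α * (b * β)) ≠ 0 := fun h => hb (eq_zero_of_dual_mul hK hτ hα hbβ h)
  have h0 : (Finset.univ.filter fun p : K × F =>
      switchLine₀ α β p ≤ LinearMap.ker (dotForm τ 0 b c)).card = Fintype.card F ^ 2 := by
    have := card_filter_eq_mul_card
      (LinearMap.toSpanSingleton F F (τ (α * (b * β))) ∘ₗ LinearMap.snd F K F)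
        (fun y => ⟨(0, y / τ (α * (b * β))), by simp [hne]⟩) (-τ (c * α))
    rw [Fintype.card_prod, card_eq_pow_finrank (K := F) (V := K), hK] at this
    have := Nat.eq_of_mul_eq_mul_right Fintype.card_pos this
    simp only [switchLine₀_le_ker]
    simpa [hbβ] using this
  rw [countP_switchLines, h0, Finset.sum_eq_zero, add_zero]
  intro g _
  rw [Finset.card_eq_zero, Finset.filter_eq_empty_iff]
  intro w _ hw
  have := (switchLine₁_le_ker.1 hw).1
  simp [switchForm_apply, hbβ, hne] at this

-- The hyperplane misses every point (u, β, 0), so all lines `switchLine₀` drop out. This is the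
-- loss of q on which the construction rests.
open Classical in
theorem countP_switchLines_of_apply_ne_zero (hT : finrank F T = 3) {τ : Dual F K}
    (hτ : τ ≠ 0) {b c α β : K} {θ : T} (hθ : θ ∉ Set.range (algebraMap F T))
    (e : T ≃ₗ[F] K × F) (hbβ : τ (b * β) ≠ 0) :
    (switchLines α β θ e).countP (fun U => U ≤ LinearMap.ker (dotForm τ 0 b c)) =
      (Fintype.card F - 1) * Fintype.card F := by
  rw [countP_switchLines, Finset.sum_congr rfl fun g _ =>
    card_filter_switchLine₁ hT hτ hθ e g (Or.inr hbβ), Finset.sum_const, Finset.card_univ,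
    Fintype.card_units, smul_eq_mul, Nat.add_eq_right, Finset.card_eq_zero,
    Finset.filter_eq_empty_iff]
  intro p _ hp
  have := (switchLine₀_le_ker.1 hp).2
  simp [hbβ] at this

-- Only the last coordinate matters. It is one of the q elements α and α + g, and at most one of
-- them is killed by τ(c ·), since τ(c) = τ(cα) = 0 would give c = 0. Each belongs to q^3 lines.
open Classical in
theorem countP_switchLines_le (hK : finrank F K = 2) (hT : finrank F T = 3) {τ : Dual F K}
    (hτ : τ ≠ 0) {c α β : K} (hα : α ∉ Set.range (algebraMap F K)) {θ : T}
    (e : T ≃ₗ[F] K × F) (hc : c ≠ 0) :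
    (switchLines α β θ e).countP (fun U => U ≤ LinearMap.ker (dotForm τ 0 0 c)) ≤
      Fintype.card F ^ 3 := by
  have h0 : ∀ p : K × F, switchLine₀ α β p ≤ LinearMap.ker (dotForm τ 0 0 c) ↔
      τ (c * α) = 0 := by
    intro p
    rw [switchLine₀_le_ker]
    simp [eq_comm]
  have h1 : ∀ (g : Fˣ) (w : T), switchLine₁ α β θ e (g, w) ≤ LinearMap.ker (dotForm τ 0 0 c) ↔
      τ (c * α) + g * τ c = 0 := by
    intro g w
    rw [switchLine₁_le_ker]
    simp only [switchForm_apply, zero_mul, mul_zero, map_zero, add_zero, neg_zero, true_and]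
    rw [zero_eq_neg]
  have hKF : Fintype.card (K × F) = Fintype.card F ^ 3 := by
    rw [Fintype.card_prod, card_eq_pow_finrank (K := F) (V := K), hK, pow_succ _ 2]
  have hT' : Fintype.card T = Fintype.card F ^ 3 := by
    rw [card_eq_pow_finrank (K := F) (V := T), hT]
  have hcτ : τ (c * α) = 0 → τ c ≠ 0 := fun h h' => hc
    (eq_zero_of_dual_mul hK hτ hα h' (by rwa [mul_comm]))
  rw [countP_switchLines]
  simp only [h0, h1, Finset.filter_const]
  by_cases h : τ (c * α) = 0
  · simp [h, hcτ h, hKF]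
  · simp only [h, if_false, Finset.card_empty, zero_add]
    by_cases hc0 : τ c = 0
    · simp [hc0, h]
    · rw [Finset.sum_eq_single_of_mem (Units.mk0 (-τ (c * α) / τ c) (by simp [h, hc0]))
        (Finset.mem_univ _)]
      · exact (Finset.card_le_univ _).trans hT'.le
      · intro g _ hg
        rw [if_neg, Finset.card_empty]
        intro h'
        apply hg
        ext
        rw [Units.val_mk0, eq_div_iff hc0]
        linear_combination h'

end Switching

/-! ### Weighted points of the plane over K -/

/-- The points `(x, y, 1)`, `(x, 1, 0)` and `(1, 0, 0)` of the projective plane over `K`, viewed as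
subspaces over `F`, with multiplicities `t₁`, `t₂` and `t₃`, respectively. -/
def planeSystem (F K : Type*) [Field F] [Field K] [Fintype K] [Algebra F K] (t₁ t₂ t₃ : ℕ) :
    Multiset (Submodule F (K × K × K)) :=
  t₁ • (Finset.univ : Finset (K × K)).val.map (fun p => pointLine F (p.1, p.2, 1)) +
    t₂ • (Finset.univ : Finset K).val.map (fun x => pointLine F (x, 1, 0)) +
    t₃ • {pointLine F (1, 0, 0)}

section Plane

variable {F K : Type*} [Field F] [Field K] [Fintype K] [Algebra F K] {t₁ t₂ t₃ : ℕ}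

theorem card_planeSystem : (planeSystem F K t₁ t₂ t₃).card =
    t₁ * Fintype.card K ^ 2 + t₂ * Fintype.card K + t₃ := by
  simp [planeSystem, Finset.card_univ, pow_two]

theorem finrank_le_of_mem_planeSystem [FiniteDimensional F K] {U : Submodule F (K × K × K)}
    (hU : U ∈ planeSystem F K t₁ t₂ t₃) : finrank F U ≤ finrank F K := by
  rcases Multiset.mem_add.1 hU with h | h
  · rcases Multiset.mem_add.1 h with h | h <;>
      obtain ⟨p, -, rfl⟩ := Multiset.mem_map.1 (Multiset.mem_of_mem_nsmul h) <;>
      exact finrank_pointLine_le _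
  · rw [Multiset.mem_singleton.1 (Multiset.mem_of_mem_nsmul h)]
    exact finrank_pointLine_le _

open Classical in
theorem countP_planeSystem {τ : Dual F K} (hτ : τ ≠ 0) (a b c : K) :
    (planeSystem F K t₁ t₂ t₃).countP (fun U => U ≤ LinearMap.ker (dotForm τ a b c)) =
      t₁ * (Finset.univ.filter fun p : K × K => a * p.1 + b * p.2 + c = 0).card +
      t₂ * (Finset.univ.filter fun x : K => a * x + b = 0).card + t₃ * if a = 0 then 1 else 0 := by
  rw [planeSystem, Multiset.countP_add, Multiset.countP_add, Multiset.countP_nsmul,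
    Multiset.countP_nsmul, Multiset.countP_nsmul, Multiset.countP_map, Multiset.countP_map,
    ← Multiset.cons_zero, Multiset.countP_cons, Multiset.countP_zero]
  simp only [pointLine_le_ker hτ, mul_one, mul_zero, add_zero, zero_add]
  rfl

open Classical in
theorem countP_planeSystem_of_ne_zero {τ : Dual F K} (hτ : τ ≠ 0) {a : K} (b c : K) (ha : a ≠ 0) :
    (planeSystem F K t₁ t₂ t₃).countP (fun U => U ≤ LinearMap.ker (dotForm τ a b c)) =
      t₁ * Fintype.card K + t₂ := by
  rw [countP_planeSystem hτ, card_affine_line c (Or.inl ha), card_affine_point b ha, if_neg ha]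
  simp

open Classical in
theorem countP_planeSystem_zero {τ : Dual F K} (hτ : τ ≠ 0) {b : K} (c : K) (hb : b ≠ 0) :
    (planeSystem F K t₁ t₂ t₃).countP (fun U => U ≤ LinearMap.ker (dotForm τ 0 b c)) =
      t₁ * Fintype.card K + t₃ := by
  rw [countP_planeSystem hτ, card_affine_line c (Or.inr hb)]
  simp [hb]

open Classical in
theorem countP_planeSystem_zero_zero {τ : Dual F K} (hτ : τ ≠ 0) {c : K} (hc : c ≠ 0) :
    (planeSystem F K t₁ t₂ t₃).countP (fun U => U ≤ LinearMap.ker (dotForm τ 0 0 c)) =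
      t₂ * Fintype.card K + t₃ := by
  rw [countP_planeSystem hτ]
  simp [hc, Finset.card_univ]

end Plane

/-! ### Exact values for linear and additive codes -/

theorem maxSystemSize_three_one (K : Type*) [Field K] [Fintype K] {i t : ℕ}
    (hi : i ≤ Fintype.card K) (ht : i ≤ t) :
    maxSystemSize K 3 1 ((Fintype.card K + 1) * t - i) =
      (((Fintype.card K ^ 2 + Fintype.card K + 1) * t - (Fintype.card K + 1) * i : ℕ) : ℕ∞) := by
  classical
  apply le_antisymm
  · refine sSup_le ?_
    rintro n ⟨S, hS, rfl⟩
    obtain ⟨c, h0, hc, hsum⟩ := hS.exists_chain_one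
    exact Nat.cast_le.2 (card_le_of_chain_three hi ht rfl h0 hc hsum)
  · have hτ : (LinearMap.id : Dual K K) ≠ 0 := fun h => one_ne_zero (DFunLike.congr_fun h (1 : K))
    -- With d = t - i, the optimal system has multiplicity t on affine points and d on the line z =
    -- 0.
    obtain ⟨d, rfl⟩ := Nat.exists_eq_add_of_le ht
    generalize hQ : Fintype.card K = Q at *
    have hs : (Q + 1) * (i + d) - i = (i + d) * Q + d := by
      rw [Nat.sub_eq_iff_eq_add (by nlinarith)]; ring
    have hcard : (planeSystem K K (i + d) d d).card = (Q ^ 2 + Q + 1) * (i + d) - (Q + 1) * i := by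
      rw [card_planeSystem, hQ]
      symm
      rw [Nat.sub_eq_iff_eq_add (by nlinarith [Nat.zero_le (Q ^ 2 * i)])]; ring
    rw [← hcard, hs]
    refine card_le_maxSystemSize (by simp) _ (fun U hU => ?_) (fun φ hφ => ?_)
      ⟨dotForm LinearMap.id 1 0 0, fun h => ?_, ?_⟩
    · simpa using finrank_le_of_mem_planeSystem hU
    · obtain ⟨a, b, c, rfl⟩ := exists_eq_dotForm hτ φ
      by_cases ha : a = 0
      · subst ha
        by_cases hb : b = 0
        · subst hb
          have hc : c ≠ 0 := by
            rintro rfl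
            exact hφ (LinearMap.ext fun p => by simp [dotForm_apply])
          rw [countP_planeSystem_zero_zero hτ hc, hQ]
          nlinarith
        · rw [countP_planeSystem_zero hτ c hb, hQ]
      · rw [countP_planeSystem_of_ne_zero hτ b c ha, hQ]
    · simpa [dotForm_apply] using DFunLike.congr_fun h ((1, 0, 0) : K × K × K)
    · rw [countP_planeSystem_of_ne_zero hτ _ _ one_ne_zero, hQ]

open Classical in
theorem countP_finset_sum {α ι : Type*} (p : α → Prop) (s : Finset ι) (f : ι → Multiset α) :
    (∑ i ∈ s, f i).countP p = ∑ i ∈ s, (f i).countP p :=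
  map_sum (Multiset.countPAddMonoidHom p) f s

-- Each family falls short of q^2 by q unless τ(bβ) = 0. Two values of f with this property would
-- give τ(b) = 0 and then τ(αb) = 0, so b = 0. Hence at most one family regains its q.
open Classical in
theorem sum_countP_switchLines_le {F K T : Type*} [Field F] [Field K] [Field T] [Algebra F K]
    [Algebra F T] [Fintype F] [Fintype K] [Fintype T] (hK : finrank F K = 2)
    (hT : finrank F T = 3) {τ : Dual F K} (hτ : τ ≠ 0) {b c α : K}
    (hα : α ∉ Set.range (algebraMap F K)) {θ : T} (hθ : θ ∉ Set.range (algebraMap F T))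
    (e : T ≃ₗ[F] K × F) (hb : b ≠ 0) (J : Finset F) :
    ∑ f ∈ J, (switchLines α (α + algebraMap F K f) θ e).countP
      (fun U => U ≤ LinearMap.ker (dotForm τ 0 b c)) ≤
        J.card * ((Fintype.card F - 1) * Fintype.card F) + min J.card 1 * Fintype.card F := by
  have hβ : ∀ f : F, τ (b * (α + algebraMap F K f)) = τ (α * b) + f * τ b := by
    intro f
    rw [mul_add, map_add, mul_comm b, mul_comm b, ← Algebra.smul_def, map_smul, smul_eq_mul]
  have hcount : ∀ f ∈ J, (switchLines α (α + algebraMap F K f) θ e).countP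
      (fun U => U ≤ LinearMap.ker (dotForm τ 0 b c)) = (Fintype.card F - 1) * Fintype.card F +
        if τ (b * (α + algebraMap F K f)) = 0 then Fintype.card F else 0 := by
    intro f _
    split_ifs with h
    · have hne : b * (α + algebraMap F K f) ≠ 0 := mul_ne_zero hb fun h0 =>
        hα ⟨-f, by rw [map_neg]; linear_combination -h0⟩
      rw [countP_switchLines_of_apply_eq_zero hK hτ hα e hne h]
      obtain ⟨q, hq⟩ : ∃ q, Fintype.card F = q + 1 :=
        ⟨_, (Nat.sub_add_cancel Fintype.card_pos).symm⟩
      rw [hq, Nat.add_sub_cancel]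
      ring
    · rw [countP_switchLines_of_apply_ne_zero hT hτ hθ e h, add_zero]
  rw [Finset.sum_congr rfl hcount, Finset.sum_add_distrib, Finset.sum_const, smul_eq_mul,
    ← Finset.sum_filter, Finset.sum_const, smul_eq_mul]
  refine Nat.add_le_add_left (Nat.mul_le_mul_right _ (le_min (Finset.card_filter_le _ _) ?_)) _
  rw [Finset.card_le_one]
  intro f hf g hg
  have h1 := (Finset.mem_filter.1 hf).2
  have h2 := (Finset.mem_filter.1 hg).2
  rw [hβ] at h1 h2
  have h3 : (f - g) * τ b = 0 := by linear_combination h1 - h2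
  rcases mul_eq_zero.1 h3 with h | h
  · exact sub_eq_zero.1 h
  · rw [h, mul_zero, add_zero] at h1
    exact absurd (eq_zero_of_dual_mul hK hτ hα h h1) hb

/-- The arithmetic behind the hyperplane counts in `le_maxSystemSize_six_two`. -/
theorem hyperplane_count_bounds {q i a b t : ℕ} (hq : 2 ≤ q) (hi : i ≤ q ^ 2)
    (hib : i + b = a * q) (hb : b + 1 ≤ q) (ht : q ^ 2 + q ≤ t) :
    (t - (a - 1)) * q ^ 2 + (t - i) + (a - 1) * q ^ 2 = (q ^ 2 + 1) * t - i ∧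
    (t - (a - 1)) * q ^ 2 + (t - i + (a - 2) * q) +
      ((a - 1) * ((q - 1) * q) + min (a - 1) 1 * q) ≤ (q ^ 2 + 1) * t - i ∧
    (t - i) * q ^ 2 + (t - i + (a - 2) * q) + (a - 1) * q ^ 3 ≤ (q ^ 2 + 1) * t - i ∧
    (t - (a - 1)) * (q ^ 2) ^ 2 + (t - i) * q ^ 2 + (t - i + (a - 2) * q) + (a - 1) * q ^ 4 =
      (q ^ 4 + q ^ 2 + 1) * t - (q ^ 2 + 1) * i + (a - 2) * q := by
  have haq : a ≤ q := by
    by_contra! h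
    nlinarith
  have e1 : (q ^ 2 + 1) * i ≤ (q ^ 4 + q ^ 2 + 1) * t := Nat.mul_le_mul (by nlinarith) (by omega)
  have e2 : i ≤ (q ^ 2 + 1) * t := by nlinarith
  have e3 : i ≤ t := by omega
  have e4 : a - 1 ≤ t := by omega
  rcases Nat.lt_or_ge a 2 with h2 | h2
  -- For a ≤ 1 nothing is switched and the system is the linear one.
  · have ha1 : a - 1 = 0 := by omega
    have ha2 : a - 2 = 0 := by omega
    have hiq : (0 : ℤ) ≤ i * q ^ 2 := by positivity
    simp only [ha1, ha2, Nat.sub_zero, zero_mul, add_zero, Nat.zero_min]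
    zify [e1, e2, e3]
    exact ⟨by ring, le_of_eq (by ring), by linear_combination hiq, by ring⟩
  · obtain ⟨k, rfl⟩ := Nat.exists_eq_add_of_le' h2
    have ha1 : k + 2 - 1 = k + 1 := rfl
    have ha2 : k + 2 - 2 = k := rfl
    rw [ha1] at e4 ⊢
    rw [ha2, Nat.min_eq_right (by omega)]
    have hq1 : 1 ≤ q := by omega
    zify [e1, e2, e3, e4, hq1]
    zify at hib hb haq hq
    refine ⟨by ring, le_of_eq (by ring), ?_, by ring⟩
    -- From b ≤ q - 1, i exceeds (a-1)q. The extra q^2 in i q^2 covers the (a-2)q additional copies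
    -- of (1,0,0).
    have h1 : ((k + 1) * q + 1 : ℤ) * q ^ 2 ≤ i * q ^ 2 :=
      mul_le_mul_of_nonneg_right (by linarith) (by positivity)
    have h3 : (k : ℤ) * q ≤ q * q := mul_le_mul_of_nonneg_right (by linarith) (by linarith)
    linear_combination h1 + h3

theorem le_maxSystemSize_six_two (F : Type*) [Field F] [Fintype F] {q i a b t : ℕ}
    (hF : Fintype.card F = q) (hi : i ≤ q ^ 2) (hib : i + b = a * q) (hb : b + 1 ≤ q)
    (ht : q ^ 2 + q ≤ t) :
    (((q ^ 4 + q ^ 2 + 1) * t - (q ^ 2 + 1) * i + (a - 2) * q : ℕ) : ℕ∞) ≤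
      maxSystemSize F 6 2 ((q ^ 2 + 1) * t - i) := by
  classical
  obtain ⟨K, _, _, _, hK⟩ := exists_finite_extension F two_ne_zero
  obtain ⟨T, _, _, _, hT⟩ := exists_finite_extension F three_ne_zero
  obtain ⟨α, hα⟩ := exists_notMem_range_algebraMap (F := F) (T := K) (by omega)
  obtain ⟨θ, hθ⟩ := exists_notMem_range_algebraMap (F := F) (T := T) (by omega)
  let e : T ≃ₗ[F] K × F := LinearEquiv.ofFinrankEq _ _ (by simp [hK, hT])
  obtain ⟨τ, hτ⟩ := exists_ne (0 : Dual F K)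
  have hq : 2 ≤ q := hF ▸ Fintype.one_lt_card
  have hKq : Fintype.card K = q ^ 2 := by rw [card_eq_pow_finrank (K := F), hK, hF]
  obtain ⟨J, hJ⟩ : ∃ J : Finset F, J.card = a - 1 := by
    obtain ⟨J, -, hJ⟩ := Finset.exists_subset_card_eq (s := (Finset.univ : Finset F)) (n := a - 1)
      (by
        rw [Finset.card_univ, hF]
        by_contra! h
        have : q + 2 ≤ a := by omega
        nlinarith)
    exact ⟨J, hJ⟩
  obtain ⟨b1, b2, b3, b4⟩ := hyperplane_count_bounds hq hi hib hb ht
  -- Each of the a-1 families replaces one copy of the affine points; the slack (a-2)q goes to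
  -- (1,0,0).
  let P := planeSystem F K (t - (a - 1)) (t - i) (t - i + (a - 2) * q) +
    ∑ f ∈ J, switchLines α (α + algebraMap F K f) θ e
  have hne : ∀ x y z : K, x ≠ 0 → P.countP (fun U => U ≤ LinearMap.ker (dotForm τ x y z)) =
      (q ^ 2 + 1) * t - i := by
    intro x y z hx
    rw [Multiset.countP_add, countP_planeSystem_of_ne_zero hτ y z hx, countP_finset_sum,
      Finset.sum_congr rfl fun f _ => countP_switchLines_of_ne_zero hK hT hτ hα hθ e hx,
      Finset.sum_const, hJ, hKq, hF, smul_eq_mul, b1]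
  have hcard : P.card = (q ^ 4 + q ^ 2 + 1) * t - (q ^ 2 + 1) * i + (a - 2) * q := by
    rw [Multiset.card_add, card_planeSystem, Multiset.card_sum,
      Finset.sum_congr rfl fun f _ => card_switchLines hK hT α (α + algebraMap F K f) θ e,
      Finset.sum_const, hJ, hKq, hF, smul_eq_mul, b4]
  rw [← hcard]
  refine card_le_maxSystemSize (by simp [hK]) P (fun U hU => ?_) (fun φ hφ => ?_)
    ⟨dotForm τ 1 0 0, fun h => hτ (LinearMap.ext fun x => ?_), hne _ _ _ one_ne_zero⟩
  · rcases Multiset.mem_add.1 hU with h | h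
    · exact (finrank_le_of_mem_planeSystem h).trans hK.le
    · obtain ⟨f, -, hf⟩ := Multiset.mem_sum.1 h
      exact finrank_le_of_mem_switchLines hf
  · obtain ⟨x, y, z, rfl⟩ := exists_eq_dotForm hτ φ
    by_cases hx : x = 0
    · subst hx
      rw [Multiset.countP_add, countP_finset_sum]
      by_cases hy : y = 0
      · subst hy
        have hz : z ≠ 0 := by
          rintro rfl
          exact hφ (LinearMap.ext fun p => by simp [dotForm_apply])
        rw [countP_planeSystem_zero_zero hτ hz, hKq]
        refine le_trans (Nat.add_le_add_left ?_ _) b3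
        have := Finset.sum_le_card_nsmul J _ _ fun f _ =>
          countP_switchLines_le hK hT hτ (β := α + algebraMap F K f) hα (θ := θ) e hz
        rwa [hJ, hF, smul_eq_mul] at this
      · rw [countP_planeSystem_zero hτ z hy, hKq]
        refine le_trans (Nat.add_le_add_left ?_ _) b2
        have := sum_countP_switchLines_le hK hT hτ (c := z) hα hθ e hy J
        rwa [hJ, hF] at this
    · exact (hne x y z hx).le
  · simpa [dotForm_apply] using DFunLike.congr_fun h ((x, 0, 0) : K × K × K)

theorem maxSystemSize_six_two (F : Type*) [Field F] [Fintype F] {q i a b t : ℕ}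
    (hF : Fintype.card F = q) (hi : i ≤ q ^ 2) (hib : i + b = a * q) (hb : b + 1 ≤ q)
    (ht : q ^ 2 + q ≤ t) : maxSystemSize F 6 2 ((q ^ 2 + 1) * t - i) =
      (((q ^ 4 + q ^ 2 + 1) * t - (q ^ 2 + 1) * i + (a - 2) * q : ℕ) : ℕ∞) := by
  refine le_antisymm (sSup_le ?_) (le_maxSystemSize_six_two F hF hi hib hb ht)
  rintro n ⟨S, hS, rfl⟩
  obtain ⟨c, h0, hc, hsum⟩ := hS.exists_chain_two
  rw [hF] at h0 hc hsum
  exact Nat.cast_le.2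
    (card_le_of_chain_six (hF ▸ Fintype.one_lt_card) hi hib hb (by omega) rfl h0 hc hsum)

theorem linearMaxSystemSize_six_two (K : Type*) [Field K] [Fintype K] {q i t : ℕ}
    (hK : Fintype.card K = q ^ 2) (hi : i ≤ q ^ 2) (ht : i ≤ t) :
    linearMaxSystemSize K 6 2 ((q ^ 2 + 1) * t - i) =
      (((q ^ 4 + q ^ 2 + 1) * t - (q ^ 2 + 1) * i : ℕ) : ℕ∞) := by
  have h : ⌈((6 : ℕ) : ℚ) / ((2 : ℕ) : ℚ)⌉₊ = 3 := by norm_num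
  rw [linearMaxSystemSize, h, ← hK, maxSystemSize_three_one K (hK ▸ hi) ht, hK]
  congr 4
  ring

theorem ceil_div_eq {q i a b : ℕ} (hq : 0 < q) (hib : i + b = a * q) (hb : b + 1 ≤ q) :
    ⌈(i : ℚ) / (q : ℚ)⌉₊ = a := by
  have hq' : (0 : ℚ) < q := by exact_mod_cast hq
  have hib' : (i : ℚ) + b = a * q := by exact_mod_cast hib
  have hb' : (b : ℚ) + 1 ≤ q := by exact_mod_cast hb
  apply le_antisymm
  · rw [Nat.ceil_le, div_le_iff₀ hq', ← hib']
    simp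
  · by_contra! h
    have h1 : (⌈(i : ℚ) / (q : ℚ)⌉₊ : ℚ) + 1 ≤ a := by exact_mod_cast h
    have h2 := Nat.le_ceil ((i : ℚ) / (q : ℚ))
    rw [div_le_iff₀ hq'] at h2
    nlinarith

theorem exists_add_eq_mul {q : ℕ} (hq : 0 < q) (i : ℕ) : ∃ a b, i + b = a * q ∧ b + 1 ≤ q := by
  -- Here a is i/q rounded up.
  refine ⟨(i + (q - 1)) / q, q - 1 - (i + (q - 1)) % q, ?_, by omega⟩
  have h1 := Nat.div_add_mod (i + (q - 1)) q
  have h2 := Nat.mod_lt (i + (q - 1)) hq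
  rw [mul_comm] at h1
  omega

/-- The subtractions are taken in `ℕ`. Under the hypotheses `(q ^ 2 + 1) * t - i` and
`(q ^ 4 + q ^ 2 + 1) * t - (q ^ 2 + 1) * i` are not truncated, while the truncated differences
`a - 2` and `⌈i / q⌉₊ - 2` are the intended `max (a - 2) 0` and `max (⌈i / q⌉ - 2) 0`. -/
theorem mainTheorem4 (q : ℕ)
    (F : Type*) [Field F] [Fintype F] (hF : Fintype.card F = q)
    (K : Type*) [Field K] [Fintype K] (hK : Fintype.card K = q ^ 2) :
    (∀ i a b t : ℕ, i ≤ q ^ 2 → (i : ℤ) = (a : ℤ) * q - b → b ≤ q - 1 → q ^ 2 + q ≤ t →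
      maxSystemSize F 6 2 ((q ^ 2 + 1) * t - i) =
          (((q ^ 4 + q ^ 2 + 1) * t - (q ^ 2 + 1) * i + (a - 2) * q : ℕ) : ℕ∞) ∧
      maxSystemSize F 6 2 ((q ^ 2 + 1) * t - i) =
        linearMaxSystemSize K 6 2 ((q ^ 2 + 1) * t - i) +
          (((⌈(i : ℚ) / (q : ℚ)⌉₊ - 2) * q : ℕ) : ℕ∞)) ∧
    {i : ℕ | i ≤ q ^ 2 ∧ ∀ t : ℕ, q ^ 2 + q ≤ t →
      linearMaxSystemSize K 6 2 ((q ^ 2 + 1) * t - i) <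
        maxSystemSize F 6 2 ((q ^ 2 + 1) * t - i)}.ncard = q * (q - 2) := by
  have hq : 2 ≤ q := hF ▸ Fintype.one_lt_card
  have hq0 : 0 < q := by omega
  refine ⟨fun i a b t hi hiab hb ht => ?_, ?_⟩
  · have hib : i + b = a * q := by zify; linarith
    have hb' : b + 1 ≤ q := by omega
    rw [maxSystemSize_six_two F hF hi hib hb' ht, linearMaxSystemSize_six_two K hK hi (by omega),
      ceil_div_eq hq0 hib hb']
    exact ⟨rfl, by push_cast; rfl⟩
  · have hset : {i : ℕ | i ≤ q ^ 2 ∧ ∀ t : ℕ, q ^ 2 + q ≤ t →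
        linearMaxSystemSize K 6 2 ((q ^ 2 + 1) * t - i) <
          maxSystemSize F 6 2 ((q ^ 2 + 1) * t - i)} = Set.Ioc (2 * q) (q ^ 2) := by
      ext i
      rw [Set.mem_ofPred_eq, Set.mem_Ioc, and_comm]
      refine and_congr_left fun hi => ?_
      obtain ⟨a, b, hib, hb⟩ := exists_add_eq_mul hq0 i
      have hlt : ∀ t, q ^ 2 + q ≤ t → (linearMaxSystemSize K 6 2 ((q ^ 2 + 1) * t - i) <
          maxSystemSize F 6 2 ((q ^ 2 + 1) * t - i) ↔ 2 * q < i) := by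
        intro t ht
        rw [maxSystemSize_six_two F hF hi hib hb ht, linearMaxSystemSize_six_two K hK hi (by omega),
          Nat.cast_lt, Nat.lt_add_right_iff_pos, Nat.mul_pos_iff_of_pos_right hq0]
        -- The gain is positive exactly when a ≥ 3, which by b ≤ q - 1 means i > 2q.
        constructor
        · intro h
          have : 3 * q ≤ a * q := Nat.mul_le_mul_right _ (by omega)
          omega
        · intro h
          have : 2 * q < a * q := by omega
          have := lt_of_mul_lt_mul_right this (Nat.zero_le q)
          omega
      exact ⟨fun h => (hlt _ le_rfl).1 (h _ le_rfl), fun h t ht => (hlt t ht).2 h⟩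
    rw [hset, ← Finset.coe_Ioc, Set.ncard_coe_finset, Nat.card_Ioc, Nat.mul_sub, pow_two,
      mul_comm 2 q]
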